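/- Let $f:\mathbb R\to\mathbb C$ be $2\pi$-periodic and integrable over a period. Write $\|g\|=\int_{-\pi}^{\pi}|g(x)|\,dx$, $\hat f(k)=\frac1{2\pi}\int_{-\pi}^{\pi}f(x)e^{-ikx}\,dx$ for $k\in\mathbb Z$, $S_n(f,x)=\sum_{k=-n}^{n}\hat f(k)e^{ikx}$, and $$E_n(f)_L=\inf_{c_{-n},\dots,c_n\in\mathbb C}\Big\|f-\sum_{k=-n}^{n}c_ke^{ikx}\Big\| .$$ A complex sequence $\mathbf c=\{c_n\}_{n\ge1}$ is said to belong to the class GBV if there is $\theta_1\in[0,\pi/2)$ such that, for every $n\ge1$, $c_n=0$ or $|\arg c_n|\le\theta_1$, and if there are an integer $N_0\ge1$ and a constant $M>0$ such that $$\sum_{n=m}^{2m}|c_n-c_{n+1}|\le M\max_{m\le n<m+N_0}|c_n|\qquad\text{for all } m=1,2,\dots$$ (for a sequence that also has a term of index $0$, that term is not constrained). Suppose that both $\{\hat f(n)\}_{n\ge0}$ and $\{\hat f(-n)\}_{n\ge1}$ belong to GBV, and let $\{\psi_n\}$ be a decreasing (that is, non-increasing) real sequence tending to $0$ with $\psi_n=O(\psi_{2n})$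 as $n\to\infty$. Then $$\|f-S_n(f)\|=O(\psi_n)\quad(n\to\infty)$$ if and only if both $$E_n(f)_L=O(\psi_n)\quad(n\to\infty)\qquad\text{and}\qquad \hat f(n)\log|n|=O(\psi_{|n|})\quad(n\in\mathbb Z,\ |n|\to\infty).$$ -/

import Mathlib

open Filter Asymptotics MeasureTheory
open scoped Real NNReal

noncomputable section

/-- Membership in `L_{2π}`: complex-valued functions of period `2π`, integrable over a period. -/
structure MemL2pi (f : ℝ → ℂ) : Prop where
  periodic : Function.Periodic f (2 * π)
  integrable : IntervalIntegrable f volume (-π) π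

/-- The norm `‖f‖ = ∫_{-π}^{π} |f(x)| dx`. -/
def normL (f : ℝ → ℂ) : ℝ := ∫ x in (-π)..π, ‖f x‖

/-- The Fourier coefficient `(2π)⁻¹ ∫_{-π}^{π} f(x) e^{-ikx} dx`. -/
def fhat (f : ℝ → ℂ) (k : ℤ) : ℂ :=
  fourierCoeffOn (neg_lt_self Real.pi_pos) f k

/-- The trigonometric polynomial `∑_{k=-n}^{n} c_k e^{ikx}`. -/
def trigPoly (n : ℕ) (c : ℤ → ℂ) (x : ℝ) : ℂ :=
  ∑ k ∈ Finset.Icc (-(n : ℤ)) n, c k * Complex.exp (Complex.I * k * x)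

/-- The `n`th partial sum `S_n(f, x)` of the Fourier series. -/
def partialSum (n : ℕ) (f : ℝ → ℂ) : ℝ → ℂ := trigPoly n (fhat f)

/-- The best approximation `E_n(f)_L` by trigonometric polynomials of degree `n`. -/
def bestApprox (n : ℕ) (f : ℝ → ℂ) : ℝ := ⨅ c : ℤ → ℂ, normL (f - trigPoly n c)

/-- The sector `K(θ) = {z : |arg z| ≤ θ}`; for `θ ≥ 0` it contains `0`, as `arg 0 = 0`. -/
def sector (θ : ℝ) : Set ℂ := {z | |Complex.arg z| ≤ θ}

/-- The class GBV. Only the terms `c 1, c 2, …` matter: the term `c 0` is unconstrained. -/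
def GBV (c : ℕ → ℂ) : Prop :=
  (∃ θ : ℝ, 0 ≤ θ ∧ θ < π / 2 ∧ ∀ n : ℕ, 1 ≤ n → c n ∈ sector θ) ∧
  ∃ N₀ : ℕ, 1 ≤ N₀ ∧ ∃ M : ℝ, 0 < M ∧ ∀ m : ℕ, 1 ≤ m →
    ∑ n ∈ Finset.Icc m (2 * m), ‖c n - c (n + 1)‖ ≤
      M * (((Finset.Ico m (m + N₀)).sup fun n => ‖c n‖₊ : ℝ≥0) : ℝ)

end

/-! ### Exponentials and trigonometric polynomials -/

/-! Necessity. `bestApprox` is at most the error of $S_n(f)$, so only the coefficients need work.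
Let $g=f-S_n(f)$, whose coefficients vanish on $[-n,n]$. Pairing $g$ with $e^{-inx}\sum_{k\le
2n}2i\sin(kx)/k$, which is bounded uniformly in $n$ (`abs_sum_sin_div_le`), leaves only $\sum_{k\le
2n}\hat f(n+k)/k$, so this sum is $O(\|g\|)$. The sector condition rules out cancellation, so
$\sum|\hat f(n+k)|/k$ is $O(\|g\|)$ too. Bounded variation over dyadic blocks bounds $|\hat f(N)|$,
for $N$ near $2n$, by short sums of $|\hat f(n+k+j)|$ for every $k\le n$; weighting by $1/k$
produces $|\hat f(N)|\log n$ (`norm_mul_log_le_sum`). The doubling condition turns $\psi_n$ into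
$\psi_N$. Frequencies $-n$ are treated symmetrically.

Sufficiency. The de la Vallée-Poussin mean $V_n$ satisfies $\|f-V_n\|\le 4E_n(f)_L$
(`normL_sub_vallPoussin_le`). The difference $V_n-S_n$ averages $S_j-S_n$ over $n\le j<2n$, and
summation by parts bounds each of these by a multiple of $\frac{\psi_n}{\log
n}\cdot\frac{n}{1+n|x|}$ (`GBV.exists_norm_sum_cexp_le`). The integral of the last factor is $O(\log
n)$, which cancels the logarithm. -/

theorem integral_cexp_int (k : ℤ) :
    ∫ x in (-π)..π, Complex.exp (Complex.I * k * x) = if k = 0 then (2 * π : ℂ) else 0 := by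
  split_ifs with hk
  · subst hk
    simp
    ring
  · have hc : Complex.I * (k : ℂ) ≠ 0 := mul_ne_zero Complex.I_ne_zero (by exact_mod_cast hk)
    rw [integral_exp_mul_complex hc]
    have h : Complex.exp (Complex.I * k * (π : ℝ)) = Complex.exp (Complex.I * k * ((-π : ℝ) : ℂ)) := by
      have : Complex.I * k * ((π : ℝ) : ℂ) =
          Complex.I * k * ((-π : ℝ) : ℂ) + k * (2 * π * Complex.I) := by
        push_cast; ring
      rw [this, Complex.exp_add, Complex.exp_int_mul_two_pi_mul_I, mul_one]
    rw [h, sub_self, zero_div]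

theorem fhat_eq_integral (f : ℝ → ℂ) (k : ℤ) :
    fhat f k = (1 / (2 * π) : ℂ) * ∫ x in (-π)..π, f x * Complex.exp (-(Complex.I * k * x)) := by
  rw [fhat, fourierCoeffOn_eq_integral, Complex.real_smul]
  congr 1
  · push_cast; ring
  · refine intervalIntegral.integral_congr fun x _ => ?_
    simp only [fourier_coe_apply, smul_eq_mul]
    rw [mul_comm]
    congr 2
    have : (π : ℂ) ≠ 0 := by exact_mod_cast Real.pi_ne_zero
    push_cast
    field_simp
    ring

theorem IntervalIntegrable.mul_cexp {f : ℝ → ℂ} (hf : IntervalIntegrable f volume (-π) π) (k : ℤ) :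
    IntervalIntegrable (fun x : ℝ => f x * Complex.exp (-(Complex.I * k * x))) volume (-π) π :=
  hf.mul_continuousOn (by fun_prop)

theorem fhat_sub {f g : ℝ → ℂ} (hf : IntervalIntegrable f volume (-π) π)
    (hg : IntervalIntegrable g volume (-π) π) (k : ℤ) :
    fhat (f - g) k = fhat f k - fhat g k := by
  simp only [fhat_eq_integral]
  rw [← mul_sub, ← intervalIntegral.integral_sub (hf.mul_cexp k) (hg.mul_cexp k)]
  simp [sub_mul]

theorem continuous_trigPoly (n : ℕ) (c : ℤ → ℂ) : Continuous (trigPoly n c) := by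
  unfold trigPoly
  fun_prop

theorem intervalIntegrable_trigPoly (n : ℕ) (c : ℤ → ℂ) :
    IntervalIntegrable (trigPoly n c) volume (-π) π :=
  (continuous_trigPoly n c).intervalIntegrable _ _

theorem fhat_trigPoly (n : ℕ) (c : ℤ → ℂ) (k : ℤ) :
    fhat (trigPoly n c) k = if k ∈ Finset.Icc (-(n : ℤ)) n then c k else 0 := by
  have h : ∀ x : ℝ, trigPoly n c x * Complex.exp (-(Complex.I * k * x)) =
      ∑ j ∈ Finset.Icc (-(n : ℤ)) n, c j * Complex.exp (Complex.I * (j - k : ℤ) * x) := by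
    intro x
    rw [trigPoly, Finset.sum_mul]
    refine Finset.sum_congr rfl fun j _ => ?_
    rw [mul_assoc, ← Complex.exp_add]
    push_cast
    ring_nf
  have hpi : (2 * π : ℂ) ≠ 0 := by
    exact_mod_cast (mul_pos two_pos Real.pi_pos).ne'
  rw [fhat_eq_integral]
  simp only [h]
  rw [intervalIntegral.integral_finsetSum
    fun j _ => Continuous.intervalIntegrable (by fun_prop) _ _]
  simp only [intervalIntegral.integral_const_mul, integral_cexp_int, sub_eq_zero, mul_ite, mul_zero]
  rw [Finset.sum_ite_eq']
  split_ifs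
  · field_simp
  · simp

theorem partialSum_trigPoly {n j : ℕ} (h : n ≤ j) (c : ℤ → ℂ) :
    partialSum j (trigPoly n c) = trigPoly n c := by
  funext x
  unfold partialSum
  simp only [trigPoly.eq_1 j, fhat_trigPoly, ite_mul, zero_mul]
  rw [← Finset.sum_filter, trigPoly]
  refine Finset.sum_congr ?_ fun _ _ => rfl
  ext k
  simp only [Finset.mem_filter, Finset.mem_Icc]
  omega

theorem partialSum_sub {f g : ℝ → ℂ} (hf : IntervalIntegrable f volume (-π) π)
    (hg : IntervalIntegrable g volume (-π) π) (n : ℕ) :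
    partialSum n (f - g) = partialSum n f - partialSum n g := by
  funext x
  simp [partialSum, trigPoly, fhat_sub hf hg, sub_mul]

theorem trigPoly_zero (c : ℤ → ℂ) (x : ℝ) : trigPoly 0 c x = c 0 := by
  simp [trigPoly]

theorem trigPoly_succ (n : ℕ) (c : ℤ → ℂ) (x : ℝ) :
    trigPoly (n + 1) c x = trigPoly n c x + (c (n + 1 : ℕ) * Complex.exp (Complex.I * x) ^ (n + 1) +
      c (-(n + 1 : ℕ)) * Complex.exp (Complex.I * (-x : ℝ)) ^ (n + 1)) := by
  have h : Finset.Icc (-((n + 1 : ℕ) : ℤ)) (n + 1 : ℕ) =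
      insert ((n + 1 : ℕ) : ℤ) (insert (-((n + 1 : ℕ) : ℤ)) (Finset.Icc (-(n : ℤ)) n)) := by
    ext k
    simp only [Finset.mem_insert, Finset.mem_Icc]
    omega
  rw [trigPoly, h, Finset.sum_insert, Finset.sum_insert, ← trigPoly, ← Complex.exp_nat_mul,
    ← Complex.exp_nat_mul]
  · push_cast
    rw [show Complex.I * ((n : ℂ) + 1) * x = ((n : ℂ) + 1) * (Complex.I * x) by ring,
      show Complex.I * (-((n : ℂ) + 1)) * x = ((n : ℂ) + 1) * (Complex.I * -x) by ring]
    ring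
  · simp only [Finset.mem_Icc]; omega
  · simp only [Finset.mem_insert, Finset.mem_Icc]; omega

/-- Negative frequencies are written as powers at the point $-x$, so that a single one-sided
estimate serves both halves. -/
theorem trigPoly_sub_trigPoly {n j : ℕ} (h : n ≤ j) (c : ℤ → ℂ) (x : ℝ) :
    trigPoly j c x - trigPoly n c x =
      ∑ k ∈ Finset.Ico (n + 1) (j + 1), c k * Complex.exp (Complex.I * x) ^ k +
      ∑ k ∈ Finset.Ico (n + 1) (j + 1), c (-k) * Complex.exp (Complex.I * (-x : ℝ)) ^ k := by
  induction j, h using Nat.le_induction with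
  | base => simp
  | succ j hj ih =>
    rw [trigPoly_succ, Finset.sum_Ico_succ_top (by omega : n + 1 ≤ j + 1),
      Finset.sum_Ico_succ_top (by omega : n + 1 ≤ j + 1), add_sub_right_comm, ih]
    ring

/-! ### The Fejér kernel and de la Vallée-Poussin means -/

/-- With $z=e^{ix}$, the right side is the increment of $|\sum_{j<m}z^j|^2$ as $m$ becomes $m+1$;
telescoping it gives `sum_trigPoly_one`. -/
theorem trigPoly_one_eq (m : ℕ) (x : ℝ) :
    trigPoly m 1 x = 1 +
      Complex.exp (Complex.I * x) ^ m *
        ∑ j ∈ Finset.range m, Complex.exp (Complex.I * (-x : ℝ)) ^ j +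
      Complex.exp (Complex.I * (-x : ℝ)) ^ m *
        ∑ j ∈ Finset.range m, Complex.exp (Complex.I * x) ^ j := by
  have hzw : Complex.exp (Complex.I * x) * Complex.exp (Complex.I * (-x : ℝ)) = 1 := by
    rw [← Complex.exp_add]; simp
  induction m with
  | zero => simp [trigPoly_zero]
  | succ m ih =>
    rw [trigPoly_succ, ih, Finset.sum_range_succ', Finset.sum_range_succ']
    generalize Complex.exp (Complex.I * x) = z at *
    generalize Complex.exp (Complex.I * (-x : ℝ)) = w at *
    simp only [pow_succ _, ← Finset.sum_mul, pow_zero, Pi.one_apply]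
    linear_combination (-z ^ m * (∑ i ∈ Finset.range m, w ^ i) -
      w ^ m * (∑ i ∈ Finset.range m, z ^ i)) * hzw

/-- Nonnegativity of the Fejér kernel, visible from the square, is all that the $L^1$ bounds below
require. -/
theorem sum_trigPoly_one (m : ℕ) (x : ℝ) :
    ∑ j ∈ Finset.range m, trigPoly j 1 x =
      ((‖∑ j ∈ Finset.range m, Complex.exp (Complex.I * x) ^ j‖ ^ 2 : ℝ) : ℂ) := by
  have hzw : Complex.exp (Complex.I * x) * Complex.exp (Complex.I * (-x : ℝ)) = 1 := by
    rw [← Complex.exp_add]; simp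
  have hconj : (starRingEnd ℂ) (Complex.exp (Complex.I * x)) =
      Complex.exp (Complex.I * (-x : ℝ)) := by
    rw [← Complex.exp_conj]; simp
  push_cast
  rw [← Complex.mul_conj', map_sum]
  simp only [map_pow, hconj]
  induction m with
  | zero => simp
  | succ m ih =>
    rw [Finset.sum_range_succ, ih, trigPoly_one_eq, Finset.sum_range_succ, Finset.sum_range_succ]
    have := congrArg (· ^ m) hzw
    simp only [mul_pow, one_pow] at this
    linear_combination -this

theorem partialSum_eq_integral {g : ℝ → ℂ} (hg : IntervalIntegrable g volume (-π) π) (n : ℕ)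
    (x : ℝ) :
    partialSum n g x = (1 / (2 * π) : ℂ) * ∫ t in (-π)..π, g t * trigPoly n 1 (x - t) := by
  simp only [partialSum, trigPoly, Finset.mul_sum]
  rw [intervalIntegral.integral_finsetSum
    fun j _ => hg.mul_continuousOn (Continuous.continuousOn (by fun_prop)), Finset.mul_sum]
  refine Finset.sum_congr rfl fun k _ => ?_
  rw [fhat_eq_integral, mul_assoc, ← intervalIntegral.integral_mul_const]
  congr 1
  refine intervalIntegral.integral_congr fun t _ => ?_
  simp only [Pi.one_apply, one_mul]
  rw [mul_assoc, ← Complex.exp_add]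
  push_cast
  ring_nf

theorem integral_partialSum (g : ℝ → ℂ) (n : ℕ) :
    ∫ x in (-π)..π, partialSum n g x = ∫ x in (-π)..π, g x := by
  have h := fhat_trigPoly n (fhat g) 0
  have hpi : (2 * π : ℂ) ≠ 0 := by
    exact_mod_cast (mul_pos two_pos Real.pi_pos).ne'
  rw [if_pos (by simp), fhat_eq_integral, fhat_eq_integral] at h
  simpa [partialSum, hpi, Real.pi_ne_zero] using h

theorem sum_partialSum_eq_integral {g : ℝ → ℂ} (hg : IntervalIntegrable g volume (-π) π) (m : ℕ)
    (x : ℝ) :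
    ∑ j ∈ Finset.range m, partialSum j g x = (1 / (2 * π) : ℂ) * ∫ t in (-π)..π,
      g t * ((‖∑ j ∈ Finset.range m, Complex.exp (Complex.I * (x - t : ℝ)) ^ j‖ ^ 2 : ℝ) : ℂ) := by
  simp only [partialSum_eq_integral hg, ← Finset.mul_sum, ← sum_trigPoly_one]
  have hi : ∀ j, IntervalIntegrable (fun t => g t * trigPoly j 1 (x - t)) volume (-π) π :=
    fun j => hg.mul_continuousOn
      ((continuous_trigPoly j 1).comp (continuous_const.sub continuous_id)).continuousOn
  rw [← intervalIntegral.integral_finsetSum fun j _ => hi j]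
  simp only [Finset.mul_sum]

/-- The kernel is nonnegative, so the triangle inequality moves the modulus onto $g$. Integrating is
then immediate, because each $S_j$ preserves the mean (`integral_partialSum`). -/
theorem norm_sum_partialSum_le {g : ℝ → ℂ} (hg : IntervalIntegrable g volume (-π) π) (m : ℕ)
    (x : ℝ) :
    ‖∑ j ∈ Finset.range m, partialSum j g x‖ ≤
      (∑ j ∈ Finset.range m, partialSum j (fun t => (‖g t‖ : ℂ)) x).re := by
  have hg' : IntervalIntegrable (fun t => (‖g t‖ : ℂ)) volume (-π) π :=
    ⟨hg.norm.1.ofReal, hg.norm.2.ofReal⟩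
  rw [sum_partialSum_eq_integral hg, sum_partialSum_eq_integral hg']
  have hpi : (-π) ≤ π := by linarith [Real.pi_pos]
  set h : ℝ → ℝ := fun t =>
    ‖∑ j ∈ Finset.range m, Complex.exp (Complex.I * (x - t : ℝ)) ^ j‖ ^ 2 with hh
  have e : ∀ t, (‖g t‖ : ℂ) * (h t : ℂ) = ((‖g t‖ * h t : ℝ) : ℂ) := fun t => by push_cast; rfl
  change ‖_ * ∫ t in (-π)..π, g t * (h t : ℂ)‖ ≤ (_ * ∫ t in (-π)..π, (‖g t‖ : ℂ) * (h t : ℂ)).re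
  simp only [e]
  rw [intervalIntegral.integral_ofReal, show (1 / (2 * π) : ℂ) = ((1 / (2 * π) : ℝ) : ℂ) by
    push_cast; rfl, ← Complex.ofReal_mul, Complex.ofReal_re, norm_mul, Complex.norm_real,
    Real.norm_of_nonneg (by positivity)]
  gcongr
  refine (intervalIntegral.norm_integral_le_integral_norm hpi).trans_eq ?_
  refine intervalIntegral.integral_congr fun t _ => ?_
  have : 0 ≤ h t := by positivity
  simp [abs_of_nonneg this]

theorem continuous_partialSum (n : ℕ) (g : ℝ → ℂ) : Continuous (partialSum n g) :=
  continuous_trigPoly _ _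

theorem normL_sum_partialSum_le {g : ℝ → ℂ} (hg : IntervalIntegrable g volume (-π) π) (m : ℕ) :
    normL (fun x => ∑ j ∈ Finset.range m, partialSum j g x) ≤ m * normL g := by
  have hpi : (-π) ≤ π := by linarith [Real.pi_pos]
  have hc : ∀ h : ℝ → ℂ, Continuous fun x => ∑ j ∈ Finset.range m, partialSum j h x := fun h =>
    continuous_finsetSum _ fun j _ => continuous_partialSum j h
  calc normL (fun x => ∑ j ∈ Finset.range m, partialSum j g x)
      ≤ ∫ x in (-π)..π, (∑ j ∈ Finset.range m, partialSum j (fun t => (‖g t‖ : ℂ)) x).re := by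
        refine intervalIntegral.integral_mono_on hpi ?_ ?_ fun x _ => norm_sum_partialSum_le hg m x
        · exact (hc g).norm.intervalIntegrable _ _
        · exact (Complex.continuous_re.comp (hc _)).intervalIntegrable _ _
    _ = (∫ x in (-π)..π, ∑ j ∈ Finset.range m, partialSum j (fun t => (‖g t‖ : ℂ)) x).re :=
        intervalIntegral.intervalIntegral_re ((hc _).intervalIntegrable _ _)
    _ = m * normL g := by
        rw [intervalIntegral.integral_finsetSum
          fun j _ => (continuous_partialSum j _).intervalIntegrable _ _]
        simp only [integral_partialSum]
        rw [intervalIntegral.integral_ofReal]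
        simp [normL]

theorem normL_mono {g : ℝ → ℂ} (hg : IntervalIntegrable g volume (-π) π) {b : ℝ → ℝ}
    (hb : IntervalIntegrable b volume (-π) π) (hgb : ∀ x ∈ Set.Icc (-π) π, ‖g x‖ ≤ b x) :
    normL g ≤ ∫ x in (-π)..π, b x :=
  intervalIntegral.integral_mono_on (by linarith [Real.pi_pos]) hg.norm hb hgb

theorem normL_sub_le {g h : ℝ → ℂ} (hg : IntervalIntegrable g volume (-π) π)
    (hh : IntervalIntegrable h volume (-π) π) : normL (g - h) ≤ normL g + normL h := by
  unfold normL
  rw [← intervalIntegral.integral_add hg.norm hh.norm]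
  exact intervalIntegral.integral_mono_on (by linarith [Real.pi_pos]) (hg.sub hh).norm
    (hg.norm.add hh.norm) fun x _ => norm_sub_le _ _

theorem normL_nonneg (g : ℝ → ℂ) : 0 ≤ normL g :=
  intervalIntegral.integral_nonneg (by linarith [Real.pi_pos]) fun _ _ => norm_nonneg _

/-- The de la Vallée-Poussin mean `n⁻¹ ∑_{j=n}^{2n-1} S_j(f)`. -/
noncomputable def vallPoussin (n : ℕ) (f : ℝ → ℂ) (x : ℝ) : ℂ :=
  (n : ℂ)⁻¹ * ∑ j ∈ Finset.Ico n (2 * n), partialSum j f x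

theorem continuous_vallPoussin (n : ℕ) (f : ℝ → ℂ) : Continuous (vallPoussin n f) :=
  continuous_const.mul (continuous_finsetSum _ fun j _ => continuous_partialSum j f)

/-- The block $[n,2n)$ is a difference of two initial segments, whose sums have norms at most
$2n\|g\|$ and $n\|g\|$. -/
theorem normL_vallPoussin_le {n : ℕ} (hn : 1 ≤ n) {g : ℝ → ℂ}
    (hg : IntervalIntegrable g volume (-π) π) : normL (vallPoussin n g) ≤ 3 * normL g := by
  have hn' : (0 : ℝ) < n := by exact_mod_cast hn
  have hc : ∀ m : ℕ, IntervalIntegrable (fun x => ∑ j ∈ Finset.range m, partialSum j g x)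
      volume (-π) π := fun m =>
    (continuous_finsetSum _ fun j _ => continuous_partialSum j g).intervalIntegrable _ _
  have h1 : normL (vallPoussin n g) = (n : ℝ)⁻¹ * normL
      ((fun x => ∑ j ∈ Finset.range (2 * n), partialSum j g x) -
        fun x => ∑ j ∈ Finset.range n, partialSum j g x) := by
    unfold normL
    rw [← intervalIntegral.integral_const_mul]
    refine intervalIntegral.integral_congr fun x _ => ?_
    simp only [vallPoussin, norm_mul, norm_inv, Complex.norm_natCast, Pi.sub_apply]
    rw [Finset.sum_Ico_eq_sub _ (by omega)]
  have h2 := (normL_sub_le (hc (2 * n)) (hc n)).trans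
    (add_le_add (normL_sum_partialSum_le hg _) (normL_sum_partialSum_le hg _))
  rw [h1]
  calc _ ≤ (n : ℝ)⁻¹ * (((2 * n : ℕ) : ℝ) * normL g + n * normL g) := by gcongr
    _ = 3 * normL g := by push_cast; field_simp; ring

theorem vallPoussin_trigPoly {n : ℕ} (hn : 1 ≤ n) (c : ℤ → ℂ) :
    vallPoussin n (trigPoly n c) = trigPoly n c := by
  have hn' : (n : ℂ) ≠ 0 := by exact_mod_cast (by omega : n ≠ 0)
  funext x
  rw [vallPoussin, Finset.sum_congr rfl fun j hj => by
    rw [partialSum_trigPoly (Finset.mem_Ico.1 hj).1 c]]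
  simp only [Finset.sum_const, Nat.card_Ico, nsmul_eq_mul]
  rw [show 2 * n - n = n by omega]
  field_simp

theorem vallPoussin_sub {f g : ℝ → ℂ} (hf : IntervalIntegrable f volume (-π) π)
    (hg : IntervalIntegrable g volume (-π) π) (n : ℕ) :
    vallPoussin n (f - g) = vallPoussin n f - vallPoussin n g := by
  funext x
  simp [vallPoussin, partialSum_sub hf hg, mul_sub]

/-- Since $V_n$ reproduces polynomials $T$ of degree $n$, $f-V_nf=(f-T)-V_n(f-T)$, and $4=1+3$. -/
theorem normL_sub_vallPoussin_le {n : ℕ} (hn : 1 ≤ n) {f : ℝ → ℂ}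
    (hf : IntervalIntegrable f volume (-π) π) :
    normL (f - vallPoussin n f) ≤ 4 * bestApprox n f := by
  rw [← div_le_iff₀' (by norm_num)]
  refine le_ciInf fun c => ?_
  have hT := intervalIntegrable_trigPoly n c
  have h : f - vallPoussin n f = (f - trigPoly n c) - vallPoussin n (f - trigPoly n c) := by
    rw [vallPoussin_sub hf hT, vallPoussin_trigPoly hn]
    abel
  have hsub : IntervalIntegrable (f - trigPoly n c) volume (-π) π := hf.sub hT
  have h1 := normL_sub_le hsub
    ((continuous_vallPoussin n (f - trigPoly n c)).intervalIntegrable (-π) π)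
  have h2 := normL_vallPoussin_le hn hsub
  rw [h, div_le_iff₀' (by norm_num)]
  linarith

theorem bestApprox_le_normL (n : ℕ) (f : ℝ → ℂ) :
    bestApprox n f ≤ normL (f - partialSum n f) :=
  ciInf_le (f := fun c => normL (f - trigPoly n c))
    ⟨0, by rintro _ ⟨c, rfl⟩; exact normL_nonneg _⟩ (fhat f)

theorem bestApprox_nonneg (n : ℕ) (f : ℝ → ℂ) : 0 ≤ bestApprox n f :=
  Real.iInf_nonneg fun _ => normL_nonneg _

/-! ### Summation by parts and exponential sums -/

theorem sum_Ico_mul_eq_by_parts (c z : ℕ → ℂ) {a b : ℕ} (hab : a ≤ b) :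
    ∑ k ∈ Finset.Ico a b, c k * z k = c b * ∑ k ∈ Finset.Ico a b, z k +
      ∑ k ∈ Finset.Ico a b, (c k - c (k + 1)) * ∑ i ∈ Finset.Ico a (k + 1), z i := by
  induction b, hab using Nat.le_induction with
  | base => simp
  | succ b hb ih =>
    rw [Finset.sum_Ico_succ_top hb, ih, Finset.sum_Ico_succ_top hb, Finset.sum_Ico_succ_top hb]
    rw [Finset.sum_Ico_succ_top hb]
    ring

theorem norm_sum_Ico_mul_le (c z : ℕ → ℂ) {a b : ℕ} (hab : a ≤ b) {B : ℝ}
    (hB : ∀ i ≤ b, ‖∑ k ∈ Finset.Ico a i, z k‖ ≤ B) :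
    ‖∑ k ∈ Finset.Ico a b, c k * z k‖ ≤
      (‖c b‖ + ∑ k ∈ Finset.Ico a b, ‖c k - c (k + 1)‖) * B := by
  rw [sum_Ico_mul_eq_by_parts c z hab, add_mul, Finset.sum_mul]
  refine (norm_add_le _ _).trans (add_le_add ?_ ((norm_sum_le _ _).trans
    (Finset.sum_le_sum fun k hk => ?_)))
  · rw [norm_mul]
    exact mul_le_mul_of_nonneg_left (hB b le_rfl) (norm_nonneg _)
  · rw [norm_mul]
    exact mul_le_mul_of_nonneg_left (hB _ (Finset.mem_Ico.1 hk).2) (norm_nonneg _)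

theorem norm_cexp_I_mul_pow (x : ℝ) (k : ℕ) : ‖Complex.exp (Complex.I * x) ^ k‖ = 1 := by
  rw [norm_pow, mul_comm, Complex.norm_exp_ofReal_mul_I, one_pow]

/-- The geometric sum is at most $2/|e^{ix}-1|=1/|\sin(x/2)|$, and Jordan's inequality gives
$|\sin(x/2)|\ge|x|/\pi$. The product form also covers $x=0$. -/
theorem norm_sum_cexp_mul_abs_le {x : ℝ} (hx : |x| ≤ π) (a b : ℕ) :
    ‖∑ k ∈ Finset.Ico a b, Complex.exp (Complex.I * x) ^ k‖ * |x| ≤ π := by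
  rcases lt_or_ge b a with h | h
  · simp [Finset.Ico_eq_empty_of_le h.le, Real.pi_pos.le]
  have h1 : (Complex.exp (Complex.I * x) - 1) *
      ∑ k ∈ Finset.Ico a b, Complex.exp (Complex.I * x) ^ k =
      Complex.exp (Complex.I * x) ^ b - Complex.exp (Complex.I * x) ^ a := by
    rw [mul_comm, geom_sum_Ico_mul _ h]
  have h2 : ‖(Complex.exp (Complex.I * x) - 1) *
      ∑ k ∈ Finset.Ico a b, Complex.exp (Complex.I * x) ^ k‖ ≤ 2 := by
    rw [h1]
    refine (norm_sub_le _ _).trans ?_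
    rw [norm_cexp_I_mul_pow, norm_cexp_I_mul_pow]
    norm_num
  rw [norm_mul, Complex.norm_exp_I_mul_ofReal_sub_one, norm_mul, Real.norm_eq_abs,
    Real.norm_eq_abs, abs_two] at h2
  have h3 : 2 / π * |x / 2| ≤ |Real.sin (x / 2)| := by
    apply Real.mul_abs_le_abs_sin
    rw [abs_div, abs_two]
    linarith
  rw [abs_div, abs_two] at h3
  have hpi := Real.pi_pos
  have h4 : |x| ≤ π * |Real.sin (x / 2)| := by
    have := mul_le_mul_of_nonneg_left h3 hpi.le
    calc |x| = π * (2 / π * (|x| / 2)) := by field_simp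
      _ ≤ _ := this
  set S := ‖∑ k ∈ Finset.Ico a b, Complex.exp (Complex.I * x) ^ k‖
  have hS : 0 ≤ S := norm_nonneg _
  calc S * |x| ≤ S * (π * |Real.sin (x / 2)|) := by gcongr
    _ = π / 2 * (2 * |Real.sin (x / 2)| * S) := by ring
    _ ≤ π / 2 * 2 := by gcongr
    _ = π := by ring

/-- The bounds $n$ and $\pi/|x|$ are merged into one continuous majorant with an explicit integral.
-/
theorem norm_sum_cexp_le {x : ℝ} (hx : |x| ≤ π) {a b n : ℕ} (hab : b ≤ a + n) :
    ‖∑ k ∈ Finset.Ico a b, Complex.exp (Complex.I * x) ^ k‖ ≤ (1 + π) * (n / (1 + n * |x|)) := by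
  have h1 := norm_sum_cexp_mul_abs_le hx a b
  have h2 : ‖∑ k ∈ Finset.Ico a b, Complex.exp (Complex.I * x) ^ k‖ ≤ n := by
    refine (norm_sum_le _ _).trans ?_
    simp only [norm_cexp_I_mul_pow, Finset.sum_const, Nat.card_Ico, nsmul_eq_mul, mul_one]
    exact_mod_cast (by omega : b - a ≤ n)
  rw [← mul_div_assoc, le_div_iff₀ (by positivity)]
  nlinarith [(Nat.cast_nonneg n : (0 : ℝ) ≤ n)]

theorem continuous_div_one_add_mul_abs (n : ℕ) :
    Continuous fun x : ℝ => (n : ℝ) / (1 + n * |x|) := by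
  refine continuous_const.div (by fun_prop) fun x => ?_
  positivity

theorem integral_div_one_add_mul_abs (n : ℕ) :
    ∫ x in (-π)..π, (n : ℝ) / (1 + n * |x|) = 2 * Real.log (1 + n * π) := by
  have hc := continuous_div_one_add_mul_abs n
  have hpi := Real.pi_pos
  have h1 : ∫ x in (0 : ℝ)..π, (n : ℝ) / (1 + n * |x|) = Real.log (1 + n * π) := by
    have : ∀ x ∈ Set.uIcc 0 π, HasDerivAt (fun x : ℝ => Real.log (1 + n * x))
        ((n : ℝ) / (1 + n * |x|)) x := by
      intro x hx
      rw [Set.uIcc_of_le hpi.le] at hx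
      have hx0 := hx.1
      rw [abs_of_nonneg hx0]
      have h0 : HasDerivAt (fun x : ℝ => 1 + n * x) n x := by
        simpa using ((hasDerivAt_id x).const_mul (n : ℝ)).const_add 1
      exact h0.log (by positivity)
    rw [intervalIntegral.integral_eq_sub_of_hasDerivAt this (hc.intervalIntegrable _ _)]
    simp
  have h2 : ∫ x in (-π)..0, (n : ℝ) / (1 + n * |x|) = Real.log (1 + n * π) := by
    rw [← h1]
    have := intervalIntegral.integral_comp_neg (a := 0) (b := π)
      (fun x : ℝ => (n : ℝ) / (1 + n * |x|))
    simpa using this.symm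
  rw [← intervalIntegral.integral_add_adjacent_intervals (hc.intervalIntegrable (-π) 0)
    (hc.intervalIntegrable 0 π), h1, h2]
  ring

theorem log_one_add_mul_pi_le {n : ℕ} (hn : 2 ≤ n) : Real.log (1 + n * π) ≤ 4 * Real.log n := by
  have hn' : (2 : ℝ) ≤ n := by exact_mod_cast hn
  rw [show 4 * Real.log n = Real.log ((n : ℝ) ^ 4) by rw [Real.log_pow]; norm_num]
  apply Real.log_le_log (by positivity)
  have := Real.pi_le_four
  have h3 : (8 : ℝ) ≤ n ^ 3 := by
    calc (8 : ℝ) = 2 ^ 3 := by norm_num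
      _ ≤ _ := by gcongr
  calc 1 + n * π ≤ 1 + n * 4 := by gcongr
    _ ≤ n * 8 := by linarith
    _ ≤ n * n ^ 3 := by gcongr
    _ = n ^ 4 := by ring

theorem abs_sum_sin_div_le {x : ℝ} (hx : |x| ≤ π) (K : ℕ) :
    |∑ k ∈ Finset.Ico 1 (K + 1), Real.sin (k * x) / k| ≤ 1 + π := by
  rcases eq_or_ne x 0 with rfl | hx0
  · simp; positivity
  have hxp : 0 < |x| := abs_pos.2 hx0
  -- The cut is at about $1/|x|$: the at most $a-1$ terms before it are each bounded by $|x|$, and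
  -- summation by parts bounds the rest by $\pi/(a|x|)\le\pi$.
  set a : ℕ := ⌊1 / |x|⌋₊ + 1 with ha
  have ha1 : ((a : ℝ) - 1) * |x| ≤ 1 := by
    rw [← le_div_iff₀ hxp]
    have := Nat.floor_le (show 0 ≤ 1 / |x| by positivity)
    rw [ha]; push_cast; linarith
  have ha2 : 1 ≤ a * |x| := by
    rw [← div_le_iff₀ hxp]
    have := (Nat.lt_floor_add_one (1 / |x|)).le
    rw [ha]; push_cast; linarith
  have hhead : ∀ b ≤ a, 1 ≤ b → |∑ k ∈ Finset.Ico 1 b, Real.sin (k * x) / k| ≤ 1 := by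
    intro b hb hb1
    calc |∑ k ∈ Finset.Ico 1 b, Real.sin (k * x) / k|
        ≤ ∑ k ∈ Finset.Ico 1 b, |x| := by
          refine (Finset.abs_sum_le_sum_abs _ _).trans (Finset.sum_le_sum fun k hk => ?_)
          have hk : (0 : ℝ) < k := by exact_mod_cast (Finset.mem_Ico.1 hk).1
          rw [abs_div, abs_of_pos hk, div_le_iff₀ hk]
          refine Real.abs_sin_le_abs.trans_eq ?_
          rw [abs_mul, abs_of_pos hk, mul_comm]
      _ = ((b : ℝ) - 1) * |x| := by
          simp [Nat.cast_sub hb1]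
      _ ≤ ((a : ℝ) - 1) * |x| := by gcongr
      _ ≤ 1 := ha1
  rcases le_total (K + 1) a with h | h
  · linarith [hhead (K + 1) h (by omega), Real.pi_pos]
  have htail : |∑ k ∈ Finset.Ico a (K + 1), Real.sin (k * x) / k| ≤ π := by
    have h1 : ∑ k ∈ Finset.Ico a (K + 1), Real.sin (k * x) / k =
        (∑ k ∈ Finset.Ico a (K + 1), ((1 / k : ℝ) : ℂ) * Complex.exp (Complex.I * x) ^ k).im := by
      rw [Complex.im_sum]
      refine Finset.sum_congr rfl fun k _ => ?_
      rw [Complex.im_ofReal_mul, ← Complex.exp_nat_mul,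
        show (k : ℂ) * (Complex.I * x) = ((k * x : ℝ) : ℂ) * Complex.I by push_cast; ring,
        Complex.exp_ofReal_mul_I_im]
      ring
    have h2 : ∀ b, a ≤ b → ∑ k ∈ Finset.Ico a b,
        ‖((1 / k : ℝ) : ℂ) - ((1 / (k + 1 : ℕ) : ℝ) : ℂ)‖ = 1 / a - 1 / b := by
      intro b hb
      induction b, hb using Nat.le_induction with
      | base => simp
      | succ b hb ih =>
        have hb0 : (0 : ℝ) < b := by exact_mod_cast (by omega : 0 < b)
        rw [Finset.sum_Ico_succ_top hb, ih, ← Complex.ofReal_sub, Complex.norm_real,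
          Real.norm_of_nonneg]
        · ring
        · rw [sub_nonneg]
          gcongr
          omega
    rw [h1]
    refine (Complex.abs_im_le_norm _).trans ((norm_sum_Ico_mul_le _ _ h (B := π / |x|)
      fun i _ => ?_).trans ?_)
    · rw [le_div_iff₀ hxp]
      exact norm_sum_cexp_mul_abs_le hx a i
    · rw [h2 _ h, Complex.norm_real, Real.norm_of_nonneg (by positivity), add_sub_cancel,
        div_mul_div_comm, one_mul, div_le_iff₀ (by positivity)]
      nlinarith [Real.pi_pos]
  rw [← Finset.sum_Ico_consecutive _ (by omega : 1 ≤ a) h]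
  exact (abs_add_le _ _).trans (add_le_add (hhead a le_rfl (by omega)) htail)

/-- Testing `g` against the bounded polynomial `e^{-imx} ∑_{k=1}^K 2i sin(kx)/k`. -/
theorem norm_sum_fhat_sub_div_le {g : ℝ → ℂ} (hg : IntervalIntegrable g volume (-π) π) (m : ℤ)
    (K : ℕ) :
    ‖∑ k ∈ Finset.Ico 1 (K + 1), (fhat g (m - k) - fhat g (m + k)) / k‖ ≤ (1 + π) * normL g := by
  have hpi := Real.pi_pos
  have h1 : ∑ k ∈ Finset.Ico 1 (K + 1), (fhat g (m - k) - fhat g (m + k)) / k =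
      (1 / (2 * π) : ℂ) * ∫ x in (-π)..π, g x * (Complex.exp (-(Complex.I * m * x)) *
        (2 * Complex.I * ((∑ k ∈ Finset.Ico 1 (K + 1), Real.sin (k * x) / k : ℝ) : ℂ))) := by
    have h2 : ∀ x : ℝ, g x * (Complex.exp (-(Complex.I * m * x)) *
        (2 * Complex.I * ((∑ k ∈ Finset.Ico 1 (K + 1), Real.sin (k * x) / k : ℝ) : ℂ))) =
        ∑ k ∈ Finset.Ico 1 (K + 1), (1 / (k : ℂ)) *
          (g x * Complex.exp (-(Complex.I * (m - k : ℤ) * x)) -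
            g x * Complex.exp (-(Complex.I * (m + k : ℤ) * x))) := by
      intro x
      rw [Complex.ofReal_sum, Finset.mul_sum, Finset.mul_sum, Finset.mul_sum]
      refine Finset.sum_congr rfl fun k _ => ?_
      have e1 : Complex.exp (-(Complex.I * (m - k : ℤ) * x)) =
          Complex.exp (-(Complex.I * m * x)) * Complex.exp ((k * x : ℝ) * Complex.I) := by
        rw [← Complex.exp_add]; push_cast; ring_nf
      have e2 : Complex.exp (-(Complex.I * (m + k : ℤ) * x)) =
          Complex.exp (-(Complex.I * m * x)) * Complex.exp (-(k * x : ℝ) * Complex.I) := by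
        rw [← Complex.exp_add]; push_cast; ring_nf
      rw [e1, e2, Complex.ofReal_div, Complex.ofReal_sin, Complex.sin, Complex.ofReal_natCast]
      linear_combination (-(g x * Complex.exp (-(Complex.I * m * x)) *
        (Complex.exp ((k * x : ℝ) * Complex.I) - Complex.exp (-(k * x : ℝ) * Complex.I)) / k)) *
        Complex.I_sq
    simp only [h2]
    rw [intervalIntegral.integral_finsetSum
      fun k _ => ((hg.mul_cexp _).sub (hg.mul_cexp _)).const_mul _, Finset.mul_sum]
    refine Finset.sum_congr rfl fun k _ => ?_
    rw [intervalIntegral.integral_const_mul,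
      intervalIntegral.integral_sub (hg.mul_cexp _) (hg.mul_cexp _), fhat_eq_integral,
      fhat_eq_integral]
    ring
  rw [h1, norm_mul, show (1 / (2 * π) : ℂ) = ((1 / (2 * π) : ℝ) : ℂ) by push_cast; rfl,
    Complex.norm_real, Real.norm_of_nonneg (by positivity)]
  have h3 : ‖∫ x in (-π)..π, g x * (Complex.exp (-(Complex.I * m * x)) *
      (2 * Complex.I * ((∑ k ∈ Finset.Ico 1 (K + 1), Real.sin (k * x) / k : ℝ) : ℂ)))‖ ≤
      ∫ x in (-π)..π, 2 * (1 + π) * ‖g x‖ := by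
    refine intervalIntegral.norm_integral_le_of_norm_le (by linarith)
      (ae_of_all _ fun x hx => ?_) (hg.norm.const_mul _)
    have := abs_sum_sin_div_le (abs_le.2 ⟨hx.1.le, hx.2⟩) K
    have e : ‖Complex.exp (-(Complex.I * m * x))‖ = 1 := by
      rw [show -(Complex.I * m * x) = ((-(m * x) : ℝ) : ℂ) * Complex.I by push_cast; ring,
        Complex.norm_exp_ofReal_mul_I]
    rw [norm_mul, norm_mul, norm_mul, norm_mul, e, Complex.norm_I, Complex.norm_real,
      Real.norm_eq_abs, Complex.norm_two, one_mul, mul_one, mul_comm]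
    gcongr
  rw [intervalIntegral.integral_const_mul] at h3
  calc _ ≤ 1 / (2 * π) * (2 * (1 + π) * normL g) := by gcongr; exact h3
    _ = (1 / π) * ((1 + π) * normL g) := by field_simp
    _ ≤ 1 * ((1 + π) * normL g) := by
        have := normL_nonneg g
        gcongr
        rw [div_le_one hpi]
        linarith [Real.pi_gt_three]
    _ = _ := one_mul _

/-! ### Sequences in the class GBV -/

theorem cos_mul_norm_le_re {θ : ℝ} (hθ : θ ≤ π) {z : ℂ} (hz : z ∈ sector θ) :
    Real.cos θ * ‖z‖ ≤ z.re := by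
  have h : Real.cos θ ≤ Real.cos z.arg := by
    rw [← Real.cos_abs z.arg]
    exact Real.cos_le_cos_of_nonneg_of_le_pi (abs_nonneg _) hθ hz
  rw [← Complex.norm_mul_cos_arg z, mul_comm]
  gcongr

/-- In a sector the real part dominates $\cos\theta$ times the modulus, and real parts add. For
$\theta<\pi/2$ this excludes cancellation. -/
theorem cos_mul_sum_norm_div_le {θ : ℝ} (hθ : θ ≤ π) {c : ℕ → ℂ}
    (hc : ∀ n, 1 ≤ n → c n ∈ sector θ) (n K : ℕ) :
    Real.cos θ * ∑ k ∈ Finset.Ico 1 K, ‖c (n + k)‖ / k ≤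
      ‖∑ k ∈ Finset.Ico 1 K, c (n + k) / k‖ := by
  refine le_trans ?_ (Complex.re_le_norm _)
  rw [Finset.mul_sum, Complex.re_sum]
  refine Finset.sum_le_sum fun k hk => ?_
  rw [Complex.div_natCast_re, ← mul_div_assoc]
  have := (Finset.mem_Ico.1 hk).1
  gcongr
  exact cos_mul_norm_le_re hθ (hc _ (by omega))

theorem norm_sub_le_sum_Icc (c : ℕ → ℂ) {m p q : ℕ} (hmp : m ≤ p) (hpq : p ≤ q)
    (hq : q ≤ 2 * m + 1) :
    ‖c p - c q‖ ≤ ∑ n ∈ Finset.Icc m (2 * m), ‖c n - c (n + 1)‖ := by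
  rw [← dist_eq_norm]
  refine (dist_le_Ico_sum_dist c hpq).trans ?_
  simp only [dist_eq_norm]
  refine Finset.sum_le_sum_of_subset_of_nonneg (fun k hk => ?_) fun _ _ _ => norm_nonneg _
  simp only [Finset.mem_Ico, Finset.mem_Icc] at hk ⊢
  omega

/-- The maximum is attained at some $p<m+N_0\le 2m$, so $p$ and $N$ both lie in $[m,2m+1]$ and the
block variation controls $|c_N-c_p|$. The sum over $j$ replaces the maximum because its terms can be
treated separately when $m$ varies. -/
theorem norm_le_of_sum_Icc_le {c : ℕ → ℂ} {m N₀ : ℕ} {M : ℝ} (hM : 0 ≤ M) (hN₀ : 1 ≤ N₀)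
    (hm : N₀ ≤ m)
    (h : ∑ n ∈ Finset.Icc m (2 * m), ‖c n - c (n + 1)‖ ≤
      M * (((Finset.Ico m (m + N₀)).sup fun n => ‖c n‖₊ : ℝ≥0) : ℝ))
    {N : ℕ} (hmN : m ≤ N) (hN : N ≤ 2 * m + 1) :
    ‖c N‖ ≤ (1 + M) * ∑ j ∈ Finset.range N₀, ‖c (m + j)‖ := by
  obtain ⟨p, hp, hpe⟩ := Finset.exists_mem_eq_sup (Finset.Ico m (m + N₀))
    ⟨m, Finset.mem_Ico.2 ⟨le_rfl, by omega⟩⟩ fun n => ‖c n‖₊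
  rw [hpe, coe_nnnorm] at h
  rw [Finset.mem_Ico] at hp
  have h1 : ‖c N - c p‖ ≤ M * ‖c p‖ := by
    rcases le_total N p with h' | h'
    · exact (norm_sub_le_sum_Icc c hmN h' (by omega)).trans h
    · rw [norm_sub_rev]
      exact (norm_sub_le_sum_Icc c hp.1 h' hN).trans h
  have h2 : ‖c p‖ ≤ ∑ j ∈ Finset.range N₀, ‖c (m + j)‖ := by
    have := Finset.single_le_sum (f := fun j => ‖c (m + j)‖) (fun _ _ => norm_nonneg _)
      (Finset.mem_range.2 (by omega : p - m < N₀))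
    simpa [Nat.add_sub_cancel' hp.1] using this
  calc ‖c N‖ = ‖(c N - c p) + c p‖ := by rw [sub_add_cancel]
    _ ≤ M * ‖c p‖ + ‖c p‖ := (norm_add_le _ _).trans (add_le_add_left h1 _)
    _ = (1 + M) * ‖c p‖ := by ring
    _ ≤ _ := by gcongr

theorem log_le_sum_inv (n : ℕ) : Real.log n ≤ ∑ k ∈ Finset.Ico 1 (n + 1), (1 : ℝ) / k := by
  have h := log_add_one_le_harmonic n
  rw [harmonic_eq_sum_Icc] at h
  push_cast at h
  simp only [one_div, Finset.Ico_add_one_right_eq_Icc]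
  refine le_trans ?_ h
  rcases Nat.eq_zero_or_pos n with rfl | hn
  · simp
  · have : (0 : ℝ) < n := by exact_mod_cast hn
    exact Real.log_le_log this (by linarith)

/-- Every $m=n+k$ with $1\le k\le n$ satisfies $m\le N\le 2m+1$, so the previous bound may be
averaged with weights $1/k$, of total mass at least $\log n$. One factor $N_0$ counts the shifts
$j$; the other pays for replacing $1/k$ by $1/(k+j)$. -/
theorem norm_mul_log_le_sum {c : ℕ → ℂ} {N₀ : ℕ} {M : ℝ} (hM : 0 ≤ M) (hN₀ : 1 ≤ N₀)
    (h : ∀ m : ℕ, 1 ≤ m → ∑ n ∈ Finset.Icc m (2 * m), ‖c n - c (n + 1)‖ ≤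
      M * (((Finset.Ico m (m + N₀)).sup fun n => ‖c n‖₊ : ℝ≥0) : ℝ))
    {n N : ℕ} (hn : N₀ ≤ n) (hN1 : 2 * n ≤ N) (hN2 : N ≤ 2 * n + 1) :
    ‖c N‖ * Real.log n ≤
      (1 + M) * N₀ ^ 2 * ∑ k ∈ Finset.Ico 1 (2 * n + 1), ‖c (n + k)‖ / k := by
  have hinner : ∀ j ∈ Finset.range N₀, ∑ k ∈ Finset.Ico 1 (n + 1), ‖c (n + k + j)‖ / k ≤
      N₀ * ∑ k ∈ Finset.Ico 1 (2 * n + 1), ‖c (n + k)‖ / k := by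
    intro j hj
    rw [Finset.mem_range] at hj
    calc ∑ k ∈ Finset.Ico 1 (n + 1), ‖c (n + k + j)‖ / k
        ≤ ∑ k ∈ Finset.Ico 1 (n + 1), N₀ * (‖c (n + (k + j))‖ / (k + j : ℕ)) := by
          refine Finset.sum_le_sum fun k hk => ?_
          have hk1 := (Finset.mem_Ico.1 hk).1
          have hk0 : (0 : ℝ) < k := by exact_mod_cast hk1
          have hkj : (0 : ℝ) < (k + j : ℕ) := by exact_mod_cast (by omega : 0 < k + j)
          rw [add_assoc, ← mul_div_assoc, div_le_div_iff₀ hk0 hkj]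
          -- This follows from $j\le N_0-1$ and $(N_0-1)(k-1)\ge 0$.
          have : ((k + j : ℕ) : ℝ) ≤ N₀ * k := by
            exact_mod_cast (by nlinarith : k + j ≤ N₀ * k)
          calc _ ≤ ‖c (n + (k + j))‖ * (N₀ * k) := by gcongr
            _ = _ := by ring
      _ = N₀ * ∑ k ∈ Finset.Ico (1 + j) (n + 1 + j), ‖c (n + k)‖ / k := by
          rw [← Finset.mul_sum, Finset.sum_Ico_add' (fun k => ‖c (n + k)‖ / (k : ℝ))]
      _ ≤ _ := by
          refine mul_le_mul_of_nonneg_left (Finset.sum_le_sum_of_subset_of_nonneg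
            (Finset.Ico_subset_Ico (by omega) (by omega)) fun _ _ _ => by positivity)
            (Nat.cast_nonneg _)
  calc ‖c N‖ * Real.log n ≤ ‖c N‖ * ∑ k ∈ Finset.Ico 1 (n + 1), (1 : ℝ) / k := by
        gcongr; exact log_le_sum_inv n
    _ ≤ ∑ k ∈ Finset.Ico 1 (n + 1),
        (1 + M) * ∑ j ∈ Finset.range N₀, ‖c (n + k + j)‖ / k := by
        rw [Finset.mul_sum]
        refine Finset.sum_le_sum fun k hk => ?_
        have hk' := Finset.mem_Ico.1 hk
        rw [mul_one_div, ← Finset.sum_div, ← mul_div_assoc]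
        gcongr
        exact norm_le_of_sum_Icc_le hM hN₀ (by omega) (h _ (by omega)) (by omega) (by omega)
    _ = (1 + M) * ∑ j ∈ Finset.range N₀, ∑ k ∈ Finset.Ico 1 (n + 1), ‖c (n + k + j)‖ / k := by
        rw [← Finset.mul_sum, Finset.sum_comm]
    _ ≤ (1 + M) * ∑ j ∈ Finset.range N₀,
        (N₀ * ∑ k ∈ Finset.Ico 1 (2 * n + 1), ‖c (n + k)‖ / k) := by
        gcongr with j hj
        exact hinner j hj
    _ = _ := by
        rw [Finset.sum_const, Finset.card_range, nsmul_eq_mul]; ring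

theorem GBV.isBigO_mul_log {c : ℕ → ℂ} (hc : GBV c) {u ψ : ℕ → ℝ} {C₁ : ℝ}
    (hu : ∀ n, ‖∑ k ∈ Finset.Ico 1 (2 * n + 1), c (n + k) / k‖ ≤ C₁ * u n)
    (huψ : u =O[atTop] ψ) (hψ : Antitone ψ) (hψ0 : ∀ n, 0 ≤ ψ n)
    (hdbl : ψ =O[atTop] fun n : ℕ => ψ (2 * n)) :
    (fun n : ℕ => c n * (Real.log n : ℂ)) =O[atTop] ψ := by
  obtain ⟨⟨θ, hθ0, hθ, hsec⟩, N₀, hN₀, M, hM, hvar⟩ := hc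
  have hcos : 0 < Real.cos θ := Real.cos_pos_of_mem_Ioo ⟨by linarith, hθ⟩
  -- Doubling is applied twice because $N$ may be $2n+1$: with $n=\lfloor N/2\rfloor\ge 1$ one has
  -- $N\le 4n$, hence $\psi_{4n}\le\psi_N$.
  have h4 : ψ =O[atTop] fun n : ℕ => ψ (2 * (2 * n)) :=
    hdbl.trans (hdbl.comp_tendsto (tendsto_id.const_mul_atTop' two_pos))
  obtain ⟨C, hC0, hC⟩ := (huψ.trans h4).exists_pos
  have hhalf : Tendsto (fun N : ℕ => N / 2) atTop atTop :=
    Nat.tendsto_div_const_atTop two_ne_zero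
  refine IsBigO.of_bound (3 * ((1 + M) * N₀ ^ 2 * ((|C₁| * C) / Real.cos θ))) ?_
  filter_upwards [hhalf.eventually hC.bound, hhalf.eventually_ge_atTop (max 2 N₀)] with N hb hN
  set n := N / 2 with hn
  have hn2 : 2 ≤ n := (le_max_left _ _).trans hN
  have h1 := norm_mul_log_le_sum hM.le hN₀ hvar ((le_max_right _ _).trans hN)
    (by omega : 2 * n ≤ N) (by omega)
  have h2 := cos_mul_sum_norm_div_le (by linarith [Real.pi_pos]) hsec n (2 * n + 1)
  have h3 : ‖u n‖ ≤ C * ψ N := by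
    refine hb.trans ?_
    rw [Real.norm_of_nonneg (hψ0 _)]
    gcongr
    exact hψ (by omega)
  have h5 : ∑ k ∈ Finset.Ico 1 (2 * n + 1), ‖c (n + k)‖ / k ≤
      (|C₁| * C) / Real.cos θ * ψ N := by
    rw [div_mul_eq_mul_div, le_div_iff₀' hcos]
    calc _ ≤ C₁ * u n := h2.trans (hu n)
      _ ≤ |C₁| * ‖u n‖ := by rw [Real.norm_eq_abs, ← abs_mul]; exact le_abs_self _
      _ ≤ |C₁| * (C * ψ N) := by gcongr
      _ = _ := by ring
  have hn' : (2 : ℝ) ≤ n := by exact_mod_cast hn2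
  have hlog : Real.log N ≤ 3 * Real.log n := by
    rw [show 3 * Real.log n = Real.log ((n : ℝ) ^ 3) by rw [Real.log_pow]; norm_num]
    have hN0 : (0 : ℝ) < N := by exact_mod_cast (by omega : 0 < N)
    apply Real.log_le_log hN0
    have : (N : ℝ) ≤ 2 * n + 1 := by exact_mod_cast (by omega : N ≤ 2 * n + 1)
    nlinarith [mul_self_nonneg ((n : ℝ) - 2), mul_nonneg (sub_nonneg.2 hn') (sub_nonneg.2 hn')]
  have hlogN : 0 ≤ Real.log N := Real.log_natCast_nonneg N
  rw [norm_mul, Complex.norm_real, Real.norm_of_nonneg hlogN, Real.norm_of_nonneg (hψ0 _)]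
  calc ‖c N‖ * Real.log N ≤ ‖c N‖ * (3 * Real.log n) := by gcongr
    _ = 3 * (‖c N‖ * Real.log n) := by ring
    _ ≤ 3 * ((1 + M) * N₀ ^ 2 * ((|C₁| * C) / Real.cos θ * ψ N)) := by
        refine mul_le_mul_of_nonneg_left (h1.trans ?_) (by norm_num)
        gcongr
    _ = _ := by ring

/-- All $|c_k|$ with $k\ge n$ are $O(\psi_n/\log n)$ by monotonicity, and GBV gives the same order
for the variation over $[n,2n]$. Summation by parts transfers this to the exponential sum. -/
theorem GBV.exists_norm_sum_cexp_le {c : ℕ → ℂ} (hc : GBV c) {ψ : ℕ → ℝ}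
    (hψ : Antitone ψ) (hψ0 : ∀ n, 0 ≤ ψ n)
    (hlog : (fun n : ℕ => c n * (Real.log n : ℂ)) =O[atTop] ψ) :
    ∃ C : ℝ, 0 ≤ C ∧ ∀ᶠ n : ℕ in atTop, ∀ j ≤ 2 * n, n ≤ j → ∀ x : ℝ, |x| ≤ π →
      ‖∑ k ∈ Finset.Ico (n + 1) (j + 1), c k * Complex.exp (Complex.I * x) ^ k‖ ≤
        C * (ψ n / Real.log n) * (n / (1 + n * |x|)) := by
  obtain ⟨-, N₀, hN₀, M, hM, hvar⟩ := hc
  obtain ⟨C, hC0, hC⟩ := hlog.exists_pos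
  refine ⟨(1 + M) * C * (1 + π), by positivity, ?_⟩
  filter_upwards [eventually_forall_ge_atTop.2 hC.bound, eventually_ge_atTop 2] with n hn hn2
    j hj2 hj x hx
  have hn1 : (1 : ℝ) < n := by exact_mod_cast hn2
  have hlogn : 0 < Real.log n := Real.log_pos hn1
  have hck : ∀ k, n ≤ k → ‖c k‖ ≤ C * (ψ n / Real.log n) := by
    intro k hk
    have hk' : (n : ℝ) ≤ k := by exact_mod_cast hk
    have h := hn k hk
    have hle : Real.log n ≤ Real.log k := Real.log_le_log (by linarith) hk'
    rw [norm_mul, Complex.norm_real, Real.norm_of_nonneg (hlogn.le.trans hle),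
      Real.norm_of_nonneg (hψ0 _)] at h
    rw [← mul_div_assoc, le_div_iff₀ hlogn]
    calc ‖c k‖ * Real.log n ≤ ‖c k‖ * Real.log k := by gcongr
      _ ≤ C * ψ k := h
      _ ≤ C * ψ n := by gcongr; exact hψ hk
  have hsum : ∑ k ∈ Finset.Ico (n + 1) (j + 1), ‖c k - c (k + 1)‖ ≤
      M * (C * (ψ n / Real.log n)) := by
    refine (Finset.sum_le_sum_of_subset_of_nonneg (fun k hk => ?_) fun _ _ _ =>
      norm_nonneg _).trans ((hvar n (by omega)).trans ?_)
    · simp only [Finset.mem_Ico, Finset.mem_Icc] at hk ⊢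
      omega
    · gcongr
      obtain ⟨p, hp, hpe⟩ := Finset.exists_mem_eq_sup (Finset.Ico n (n + N₀))
        ⟨n, Finset.mem_Ico.2 ⟨le_rfl, by omega⟩⟩ fun n => ‖c n‖₊
      rw [hpe, coe_nnnorm]
      exact hck p (Finset.mem_Ico.1 hp).1
  refine (norm_sum_Ico_mul_le c _ (by omega : n + 1 ≤ j + 1) fun i hi =>
    norm_sum_cexp_le hx (n := n) (by omega)).trans ?_
  calc _ ≤ (C * (ψ n / Real.log n) + M * (C * (ψ n / Real.log n))) *
        ((1 + π) * (n / (1 + n * |x|))) := by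
        gcongr
        exact hck _ (by omega)
    _ = _ := by ring

theorem isBigO_cofinite_int_iff {E F : Type*} [SeminormedAddCommGroup E] [SeminormedAddCommGroup F]
    {f : ℤ → E} {g : ℤ → F} :
    f =O[cofinite] g ↔ ((fun n : ℕ => f n) =O[atTop] fun n : ℕ => g n) ∧
      ((fun n : ℕ => f (-n)) =O[atTop] fun n : ℕ => g (-n)) := by
  rw [Int.cofinite_eq, isBigO_sup, and_comm, ← Nat.map_cast_int_atTop, isBigO_map,
    ← Filter.map_neg_atTop, ← Nat.map_cast_int_atTop, isBigO_map, isBigO_map]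
  rfl

/-! ### Convergence in the mean -/

theorem fhat_sub_partialSum {f : ℝ → ℂ} (hf : IntervalIntegrable f volume (-π) π) (n : ℕ)
    (k : ℤ) :
    fhat (f - partialSum n f) k = if k ∈ Finset.Icc (-(n : ℤ)) n then 0 else fhat f k := by
  rw [partialSum, fhat_sub hf (intervalIntegrable_trigPoly _ _), fhat_trigPoly]
  split_ifs <;> simp

/-- The test polynomial is centred at frequency $\pm n$. For $1\le k\le 2n$, one of the two
frequencies at distance $k$ lies in $[-n,n]$, where the coefficients of the remainder vanish, and
the other lies outside; $2n$ is the largest range with this property. -/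
theorem norm_sum_fhat_div_le {f : ℝ → ℂ} (hf : IntervalIntegrable f volume (-π) π) (n : ℕ) :
    ‖∑ k ∈ Finset.Ico 1 (2 * n + 1), fhat f ((n + k : ℕ) : ℤ) / k‖ ≤
        (1 + π) * normL (f - partialSum n f) ∧
      ‖∑ k ∈ Finset.Ico 1 (2 * n + 1), fhat f (-((n + k : ℕ) : ℤ)) / k‖ ≤
        (1 + π) * normL (f - partialSum n f) := by
  have hg : IntervalIntegrable (f - partialSum n f) volume (-π) π :=
    hf.sub (intervalIntegrable_trigPoly _ _)
  constructor
  · refine le_trans (le_of_eq ?_) (norm_sum_fhat_sub_div_le hg n (2 * n))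
    rw [← norm_neg, ← Finset.sum_neg_distrib]
    congr 1
    refine Finset.sum_congr rfl fun k hk => ?_
    rw [Finset.mem_Ico] at hk
    rw [fhat_sub_partialSum hf, fhat_sub_partialSum hf,
      if_pos (by rw [Finset.mem_Icc]; omega), if_neg (by rw [Finset.mem_Icc]; omega)]
    push_cast
    ring
  · refine le_trans (le_of_eq ?_) (norm_sum_fhat_sub_div_le hg (-n) (2 * n))
    congr 1
    refine Finset.sum_congr rfl fun k hk => ?_
    rw [Finset.mem_Ico] at hk
    rw [fhat_sub_partialSum hf, fhat_sub_partialSum hf,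
      if_neg (by rw [Finset.mem_Icc]; omega), if_pos (by rw [Finset.mem_Icc]; omega)]
    push_cast
    rw [sub_zero, neg_add']

theorem norm_vallPoussin_sub_partialSum_le {f : ℝ → ℂ} {n : ℕ} (hn : 1 ≤ n) {x B : ℝ}
    (h : ∀ j ≤ 2 * n, n ≤ j → ‖partialSum j f x - partialSum n f x‖ ≤ B) :
    ‖(partialSum n f - vallPoussin n f) x‖ ≤ B := by
  have hn0 : (0 : ℝ) < n := by exact_mod_cast hn
  have hn' : (n : ℂ) ≠ 0 := by exact_mod_cast (by omega : n ≠ 0)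
  have e : (partialSum n f - vallPoussin n f) x =
      -((n : ℂ)⁻¹ * ∑ j ∈ Finset.Ico n (2 * n), (partialSum j f x - partialSum n f x)) := by
    rw [Finset.sum_sub_distrib, Finset.sum_const, Nat.card_Ico, show 2 * n - n = n by omega,
      Pi.sub_apply, vallPoussin, nsmul_eq_mul]
    field_simp
    ring
  rw [e, norm_neg, norm_mul, norm_inv, Complex.norm_natCast, inv_mul_le_iff₀ hn0]
  refine (norm_sum_le_of_le _ fun j hj => ?_).trans_eq (b := ∑ j ∈ Finset.Ico n (2 * n), B) ?_
  · rw [Finset.mem_Ico] at hj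
    exact h j hj.2.le hj.1
  · rw [Finset.sum_const, Nat.card_Ico, show 2 * n - n = n by omega, nsmul_eq_mul]

theorem isBigO_normL_partialSum_sub_vallPoussin {f : ℝ → ℂ}
    (hpos : GBV fun n : ℕ => fhat f (n : ℤ)) (hneg : GBV fun n : ℕ => fhat f (-(n : ℤ)))
    {ψ : ℕ → ℝ} (hψ : Antitone ψ) (hψ0 : ∀ n, 0 ≤ ψ n)
    (hp : (fun n : ℕ => fhat f (n : ℤ) * (Real.log n : ℂ)) =O[atTop] ψ)
    (hm : (fun n : ℕ => fhat f (-(n : ℤ)) * (Real.log n : ℂ)) =O[atTop] ψ) :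
    (fun n : ℕ => normL (partialSum n f - vallPoussin n f)) =O[atTop] ψ := by
  obtain ⟨A, hA0, hA⟩ := hpos.exists_norm_sum_cexp_le hψ hψ0 hp
  obtain ⟨B, hB0, hB⟩ := hneg.exists_norm_sum_cexp_le hψ hψ0 hm
  -- Here $8=2\cdot 4$: the majorant has integral $2\log(1+n\pi)$, and $\log(1+n\pi)\le 4\log n$.
  refine IsBigO.of_bound ((A + B) * 8) ?_
  filter_upwards [hA, hB, eventually_ge_atTop 2] with n hAn hBn hn
  have hn1 : (1 : ℝ) < n := by exact_mod_cast hn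
  have hlogn : 0 < Real.log n := Real.log_pos hn1
  have hψn := hψ0 n
  have hpt : ∀ x ∈ Set.Icc (-π) π, ‖(partialSum n f - vallPoussin n f) x‖ ≤
      (A + B) * (ψ n / Real.log n) * (n / (1 + n * |x|)) := by
    intro x hx
    refine norm_vallPoussin_sub_partialSum_le (by omega) fun j hj2 hj => ?_
    rw [partialSum, partialSum, trigPoly_sub_trigPoly hj]
    have hx' : |x| ≤ π := abs_le.2 hx
    have h1 := hAn j hj2 hj x hx'
    have h2 := hBn j hj2 hj (-x) (by rwa [abs_neg])
    rw [abs_neg] at h2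
    refine (norm_add_le _ _).trans ((add_le_add h1 h2).trans_eq (by ring))
  have h := normL_mono (((continuous_partialSum n f).sub
    (continuous_vallPoussin n f)).intervalIntegrable _ _)
    (((continuous_div_one_add_mul_abs n).const_mul _).intervalIntegrable _ _) hpt
  rw [intervalIntegral.integral_const_mul, integral_div_one_add_mul_abs] at h
  rw [Real.norm_of_nonneg (normL_nonneg _), Real.norm_of_nonneg hψn]
  calc _ ≤ (A + B) * (ψ n / Real.log n) * (2 * Real.log (1 + n * π)) := h
    _ ≤ (A + B) * (ψ n / Real.log n) * (2 * (4 * Real.log n)) := by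
        gcongr
        exact log_one_add_mul_pi_le hn
    _ = _ := by field_simp; ring

theorem theorem2 (f : ℝ → ℂ) (hf : MemL2pi f)
    (hpos : GBV fun n : ℕ => fhat f (n : ℤ))
    (hneg : GBV fun n : ℕ => fhat f (-(n : ℤ)))
    (ψ : ℕ → ℝ) (hψ_anti : Antitone ψ) (hψ_lim : Tendsto ψ atTop (nhds 0))
    (hψ_dbl : ψ =O[atTop] fun n : ℕ => ψ (2 * n)) :
    ((fun n : ℕ => normL (f - partialSum n f)) =O[atTop] ψ) ↔
      ((fun n : ℕ => bestApprox n f) =O[atTop] ψ) ∧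
      ((fun n : ℤ => fhat f n * (Real.log |(n : ℝ)| : ℂ)) =O[cofinite]
        fun n : ℤ => ψ n.natAbs) := by
  have hψ0 : ∀ n, 0 ≤ ψ n := fun n => hψ_anti.le_of_tendsto hψ_lim n
  have hi := hf.integrable
  rw [isBigO_cofinite_int_iff]
  simp only [Int.natAbs_neg, Int.natAbs_natCast, Int.cast_neg, Int.cast_natCast, abs_neg,
    Nat.abs_cast]
  constructor
  · intro h
    refine ⟨(IsBigO.of_norm_le fun n => ?_).trans h, ?_, ?_⟩
    · rw [Real.norm_of_nonneg (bestApprox_nonneg n f)]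
      exact bestApprox_le_normL n f
    · exact hpos.isBigO_mul_log (fun n => (norm_sum_fhat_div_le hi n).1) h hψ_anti hψ0 hψ_dbl
    · exact hneg.isBigO_mul_log (fun n => (norm_sum_fhat_div_le hi n).2) h hψ_anti hψ0 hψ_dbl
  · rintro ⟨hE, hp, hm⟩
    refine IsBigO.trans ?_ ((hE.const_mul_left 4).add
      (isBigO_normL_partialSum_sub_vallPoussin hpos hneg hψ_anti hψ0 hp hm))
    refine IsBigO.of_bound 1 ?_
    filter_upwards [eventually_ge_atTop 1] with n hn
    have hV := (continuous_vallPoussin n f).intervalIntegrable (μ := volume) (-π) π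
    have h1 : normL (f - partialSum n f) ≤
        normL (f - vallPoussin n f) + normL (partialSum n f - vallPoussin n f) := by
      rw [← sub_sub_sub_cancel_right f (partialSum n f) (vallPoussin n f)]
      exact normL_sub_le (hi.sub hV)
        (((continuous_partialSum n f).intervalIntegrable _ _).sub hV)
    rw [one_mul, Real.norm_of_nonneg (normL_nonneg _)]
    exact (h1.trans (add_le_add_left (normL_sub_vallPoussin_le hn hi) _)).trans (le_abs_self _)
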